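/- Let $\sigma_1\ge\sigma_2>0$ be real numbers with $\sigma_1+\sigma_2=1$, and let $\theta_{11},\theta_{12}$ be real numbers that are not both rational. Let $\hat\omega\in[-\infty,+\infty]$ be the supremum of the real numbers $\gamma$ such that, for every sufficiently large real $t$, the system $$|x_1|^{1/\sigma_1}\le t,\qquad |x_2|^{1/\sigma_2}\le t,\qquad |\theta_{11}x_1+\theta_{12}x_2-y|\le t^{-\gamma}$$ has a nonzero solution $(x_1,x_2,y)\in\mathbb Z^3$. Let ${}^{\mathrm t}\hat\omega\in[-\infty,+\infty]$ be the supremum of the real numbers $\gamma$ such that, for every sufficiently large real $t$, the system $$|x|\le t,\qquad |\theta_{11}x-y_1|^{1/\sigma_1}\le t^{-\gamma},\qquad |\theta_{12}x-y_2|^{1/\sigma_2}\le t^{-\gamma}$$ has a nonzero solution $(x,y_1,y_2)\in\mathbb Z^3$. Then, with the convention $(+\infty)^{-1}=0$ (note that $\hat\omega\ge1$ by Minkowski's theorem), $$\sigma_1\,{}^{\mathrm t}\hat\omega+\sigma_2\,\hat\omega^{-1}\ge1\qquad\text{and}\qquad \sigma_2\,{}^{\mathrm t}\hat\omega+\sigma_1\,\hat\omega^{-1}\le1.$$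 Moreover, if $\theta_{11}$ is irrational, then $\sigma_1\,{}^{\mathrm t}\hat\omega\le1$. -/

import Mathlib

open Filter

/-- A vector of weights: positive reals in non-increasing order that sum to `1`. -/
def IsWeightVector {k : ℕ} (w : Fin k → ℝ) : Prop :=
  (∀ i, 0 < w i) ∧ Antitone w ∧ ∑ i, w i = 1

/-- The weighted norm `|z|_w = max_i |z_i| ^ (1 / w_i)`. -/
noncomputable def weightedNorm {k : ℕ} (w z : Fin k → ℝ) : ℝ :=
  ⨆ i, |z i| ^ (1 / w i)

/-- The system `|x|_σ ≤ t`, `|Θ x - y|_ρ ≤ t ^ (-γ)` has a nonzero integer solution `(x, y)`. -/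
def HasNonzeroSolution {m n : ℕ} (σ : Fin m → ℝ) (ρ : Fin n → ℝ)
    (Θ : Matrix (Fin n) (Fin m) ℝ) (γ t : ℝ) : Prop :=
  ∃ (x : Fin m → ℤ) (y : Fin n → ℤ), (x, y) ≠ (0, 0) ∧
    weightedNorm σ (fun j => (x j : ℝ)) ≤ t ∧
    weightedNorm ρ (fun i => Θ.mulVec (fun j => (x j : ℝ)) i - (y i : ℝ)) ≤ t ^ (-γ)

/-- The uniform weighted Diophantine exponent: the supremum, in the extended reals, of the real `γ`
for which the system has a nonzero integer solution for every sufficiently large real `t`. -/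
noncomputable def uniformWeightedExponent {m n : ℕ} (σ : Fin m → ℝ) (ρ : Fin n → ℝ)
    (Θ : Matrix (Fin n) (Fin m) ℝ) : EReal :=
  sSup ((fun γ : ℝ => (γ : EReal)) '' {γ : ℝ | ∀ᶠ t : ℝ in atTop, HasNonzeroSolution σ ρ Θ γ t})

/-! Both inequalities are transference between the form L = θ₁₁x₁ + θ₁₂x₂ − y and the dual pair θ₁₁x
− y₁, θ₁₂x − y₂. A single, sufficiently good solution of one system yields a solution of the other
by Minkowski's theorem (`exists_int_vec_of_compound`). If the solution is not good enough, uniform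
solvability supplies a second one at a suitable parameter, and the cross product of the two vectors
solves the dual system, since the quantities to be bounded are 2×2 minors in the sizes and errors of
both points. The first point is chosen minimal, so the second cannot be proportional to it and the
product is nonzero.

Carried out in both directions this gives `pointBox_of_forall_formBox` and
`formBox_of_forall_pointBox`. Each direction produces two conditions, one per weight; because σ₁ ≥
σ₂ and the exponents are at least 1, one of them implies the other and becomes the stated
inequality. Multiplicative constants vanish on passing to suprema.

The last claim, and the finiteness of the dual exponent, come from one irrational number: with
exponent above 1, approximations at t and 2t would be proportional, forcing rationality. -/

/-! ### Minkowski's theorem and compound boxes -/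

open MeasureTheory in
/-- Minkowski's linear forms theorem, with strict inequalities. -/
theorem exists_int_vec_of_abs_det_lt {ι : Type*} [Fintype ι] [DecidableEq ι] (M : Matrix ι ι ℝ)
    (c : ι → ℝ) (hc : ∀ i, 0 < c i) (hM : M.det ≠ 0) (h : |M.det| < ∏ i, c i) :
    ∃ v : ι → ℤ, v ≠ 0 ∧ ∀ i, |M.mulVec (fun j => (v j : ℝ)) i| < c i := by
  classical
  set S : Set (ι → ℝ) := Set.univ.pi fun i => Set.Ioo (-c i) (c i) with hS
  have hdet : LinearMap.det (Matrix.toLin' M) ≠ 0 := by rwa [LinearMap.det_toLin']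
  have hfund := ZSpan.isAddFundamentalDomain (Pi.basisFun ℝ ι) (volume : Measure (ι → ℝ))
  have : Countable (Submodule.span ℤ (Set.range (Pi.basisFun ℝ ι))).toAddSubgroup := by
    change Countable (Submodule.span ℤ (Set.range (Pi.basisFun ℝ ι)))
    infer_instance
  have hvol : volume (Matrix.toLin' M ⁻¹' S)
      = ENNReal.ofReal (|M.det|⁻¹ * ∏ i, (2 * c i)) := by
    rw [Measure.addHaar_preimage_linearMap _ hdet, LinearMap.det_toLin', hS, volume_pi_pi,
      abs_inv, ENNReal.ofReal_mul (inv_nonneg.2 (abs_nonneg _)),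
      ENNReal.ofReal_prod_of_nonneg (fun i _ => by linarith [hc i])]
    congr 1
    refine Finset.prod_congr rfl fun i _ => ?_
    rw [Real.volume_Ioo]
    congr 1
    ring
  obtain ⟨⟨x, hx⟩, hx0, hxS⟩ := exists_ne_zero_mem_lattice_of_measure_mul_two_pow_lt_measure
    (E := ι → ℝ) (μ := volume) (F := ZSpan.fundamentalDomain (Pi.basisFun ℝ ι))
    (L := (Submodule.span ℤ (Set.range (Pi.basisFun ℝ ι))).toAddSubgroup)
    (s := Matrix.toLin' M ⁻¹' S) hfund
    (by
      intro x hx i hi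
      have := hx i hi
      simp only [map_neg, Pi.neg_apply, Set.mem_Ioo] at this ⊢
      constructor <;> linarith [this.1, this.2])
    ((convex_pi fun i _ => convex_Ioo _ _).linear_preimage _)
    (by
      rw [hvol, ZSpan.volume_fundamentalDomain]
      have h1 : (Matrix.of ⇑(Pi.basisFun ℝ ι)).det = 1 := by
        rw [← Matrix.det_one (n := ι) (R := ℝ)]
        congr 1
        ext i j
        simp [Pi.single_apply, Matrix.one_apply, eq_comm]
      rw [h1, abs_one, ENNReal.ofReal_one, one_mul, Module.finrank_fintype_fun_eq_card,
        show (2 : ENNReal) ^ Fintype.card ι = ENNReal.ofReal (2 ^ Fintype.card ι) by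
          rw [ENNReal.ofReal_pow (by norm_num)]; simp,
        ENNReal.ofReal_lt_ofReal_iff_of_nonneg (by positivity), Finset.prod_mul_distrib,
        Finset.prod_const, Finset.card_univ]
      have hp : 0 < |M.det| := abs_pos.2 hM
      rw [← div_eq_inv_mul, lt_div_iff₀ hp]
      exact mul_lt_mul_of_pos_left h (by positivity))
  rw [Submodule.mem_toAddSubgroup, Module.Basis.mem_span_iff_repr_mem] at hx
  choose v hv using hx
  have hxv : x = fun j => (v j : ℝ) := by
    ext j
    have := hv j
    simp only [Pi.basisFun_repr] at this
    exact this.symm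
  refine ⟨v, ?_, fun i => ?_⟩
  · rintro rfl
    apply hx0
    ext j
    simp [hxv]
  · have := hxS i (Set.mem_univ i)
    rw [Matrix.toLin'_apply] at this
    simp only [hxv] at this
    exact abs_lt.2 this

/-- If an integral combination `a` of the rows of a unimodular `F` lies in the compound of the box
with sides `s`, then four times that box contains the `F`-image of a nonzero integer vector. -/
theorem exists_int_vec_of_compound (F : Matrix (Fin 3) (Fin 3) ℝ) (hF : |F.det| = 1)
    (a s : Fin 3 → ℝ) (n : Fin 3 → ℤ) (ha : a ≠ 0) (hs : ∀ i, 0 < s i)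
    (hn : ∀ j, ∑ i, a i * F i j = n j) (h : ∀ i, |a i| * s i ≤ s 0 * s 1 * s 2) :
    ∃ v : Fin 3 → ℤ, v ≠ 0 ∧ ∀ i, |F.mulVec (fun j => (v j : ℝ)) i| ≤ 4 * s i := by
  obtain ⟨k, -, hk⟩ := Finset.exists_max_image Finset.univ (fun i => |a i| * s i) ⟨0, by simp⟩
  have hak : 0 < |a k| := by
    by_contra! hcon
    apply ha
    ext i
    have h1 := hk i (Finset.mem_univ _)
    have h2 : |a k| * s k ≤ 0 := mul_nonpos_of_nonpos_of_nonneg hcon (hs k).le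
    have h3 : |a i| ≤ 0 := by
      by_contra! h4
      have := mul_pos h4 (hs i)
      linarith
    simpa using h3
  have hdet : (F.updateRow k (fun j => (n j : ℝ))).det = a k * F.det := by
    have : (fun j => (n j : ℝ)) = ∑ i, a i • F i := by
      ext j
      simp [← hn j]
    rw [this, Matrix.det_updateRow_sum, smul_eq_mul]
  -- The bound 1 on the new row forces the integer n · v to vanish, so the k-th form is recovered
  -- from the other two. Since |a k| is at most the product of the two other sides, doubling these
  -- makes Minkowski's inequality strict.
  obtain ⟨v, hv0, hv⟩ := exists_int_vec_of_abs_det_lt (F.updateRow k (fun j => (n j : ℝ)))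
    (Function.update (fun i => 2 * s i) k 1)
    (by
      intro i
      rcases eq_or_ne i k with rfl | hik
      · simp
      · simp [hik, hs i])
    (by
      rw [hdet]
      refine mul_ne_zero (abs_pos.1 hak) fun h0 => ?_
      simp [h0] at hF)
    (by
      rw [hdet, abs_mul, hF, mul_one]
      have h0 := hs 0
      have h1 := hs 1
      have h2 := hs 2
      have hk' := h k
      rw [Fin.prod_univ_three]
      fin_cases k <;> simp [Function.update] at hk' hak ⊢
      · have : |a 0| ≤ s 1 * s 2 := by
          refine le_of_mul_le_mul_right ?_ h0
          linarith
        nlinarith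
      · have : |a 1| ≤ s 0 * s 2 := by
          refine le_of_mul_le_mul_right ?_ h1
          linarith
        nlinarith
      · have : |a 2| ≤ s 0 * s 1 := by
          refine le_of_mul_le_mul_right ?_ h2
          linarith
        nlinarith)
  refine ⟨v, hv0, ?_⟩
  set f : Fin 3 → ℝ := F.mulVec (fun j => (v j : ℝ)) with hf
  have hother : ∀ i, i ≠ k → |f i| ≤ 2 * s i := by
    intro i hi
    have := hv i
    rw [Function.update_of_ne hi] at this
    simp only [Matrix.mulVec, Matrix.updateRow_ne hi] at this
    exact this.le
  have hcomb : ∑ i, a i * f i = 0 := by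
    have h1 := hv k
    simp only [Function.update_self, Matrix.mulVec, Matrix.updateRow_self, dotProduct] at h1
    have h2 : ∑ j, (n j : ℝ) * (v j : ℝ) = ((∑ j, n j * v j : ℤ) : ℝ) := by push_cast; rfl
    rw [h2] at h1
    have h3 : (∑ j, n j * v j : ℤ) = 0 := by
      rw [← Int.cast_abs] at h1
      exact Int.abs_lt_one_iff.1 (by exact_mod_cast h1)
    rw [h3] at h2
    rw [Int.cast_zero] at h2
    rw [← h2]
    simp only [hf, Matrix.mulVec, dotProduct, ← hn, Finset.mul_sum, Finset.sum_mul]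
    rw [Finset.sum_comm]
    exact Finset.sum_congr rfl fun j _ => Finset.sum_congr rfl fun i _ => by ring
  intro i
  rcases eq_or_ne i k with rfl | hik
  · have key : |a i| * |f i| ≤ |a i| * (4 * s i) := by
      have h1 : a i * f i = -∑ j ∈ Finset.univ.erase i, a j * f j := by
        rw [← Finset.add_sum_erase _ _ (Finset.mem_univ i)] at hcomb
        linarith
      rw [← abs_mul, h1, abs_neg]
      refine (Finset.abs_sum_le_sum_abs _ _).trans ?_
      -- Maximality of |a i| * s i bounds each of the two remaining terms; together they give the
      -- factor 4.
      have h2 : ∀ j ∈ Finset.univ.erase i, |a j * f j| ≤ 2 * (|a i| * s i) := by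
        intro j hj
        rw [abs_mul]
        have h3 := mul_le_mul_of_nonneg_left (hother j (Finset.ne_of_mem_erase hj))
          (abs_nonneg (a j))
        have h4 := hk j (Finset.mem_univ j)
        linarith
      refine (Finset.sum_le_card_nsmul _ _ _ h2).trans ?_
      rw [Finset.card_erase_of_mem (Finset.mem_univ i)]
      simp
      linarith
    exact le_of_mul_le_mul_left key hak
  · linarith [hother i hik, hs i]

/-! ### The two dual systems as boxes -/

/-- There is a nonzero integer point `(x₁, x₂, y)` with `|x₁| ≤ A₁`, `|x₂| ≤ A₂` and
`|p x₁ + q x₂ - y| ≤ B`. -/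
def FormBox (p q A₁ A₂ B : ℝ) : Prop :=
  ∃ x₁ x₂ y : ℤ, ¬ (x₁ = 0 ∧ x₂ = 0 ∧ y = 0) ∧ |(x₁ : ℝ)| ≤ A₁ ∧ |(x₂ : ℝ)| ≤ A₂ ∧
    |p * x₁ + q * x₂ - y| ≤ B

/-- There is a nonzero integer point `(x, y₁, y₂)` with `|x| ≤ T`, `|p x - y₁| ≤ B₁` and
`|q x - y₂| ≤ B₂`. -/
def PointBox (p q T B₁ B₂ : ℝ) : Prop :=
  ∃ x y₁ y₂ : ℤ, ¬ (x = 0 ∧ y₁ = 0 ∧ y₂ = 0) ∧ |(x : ℝ)| ≤ T ∧ |p * x - y₁| ≤ B₁ ∧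
    |q * x - y₂| ≤ B₂

theorem FormBox.mono {p q A₁ A₂ B A₁' A₂' B' : ℝ} (h : FormBox p q A₁ A₂ B) (h₁ : A₁ ≤ A₁')
    (h₂ : A₂ ≤ A₂') (hB : B ≤ B') : FormBox p q A₁' A₂' B' := by
  obtain ⟨x₁, x₂, y, h0, h3, h4, h5⟩ := h
  exact ⟨x₁, x₂, y, h0, h3.trans h₁, h4.trans h₂, h5.trans hB⟩

theorem PointBox.mono {p q T B₁ B₂ T' B₁' B₂' : ℝ} (h : PointBox p q T B₁ B₂) (hT : T ≤ T')
    (h₁ : B₁ ≤ B₁') (h₂ : B₂ ≤ B₂') : PointBox p q T' B₁' B₂' := by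
  obtain ⟨x, y₁, y₂, h0, h3, h4, h5⟩ := h
  exact ⟨x, y₁, y₂, h0, h3.trans hT, h4.trans h₁, h5.trans h₂⟩

theorem abs_det_formMatrix (p q : ℝ) : |(!![1, 0, 0; 0, 1, 0; p, q, -1] :
    Matrix (Fin 3) (Fin 3) ℝ).det| = 1 := by
  simp [Matrix.det_fin_three]

theorem abs_det_pointMatrix (p q : ℝ) : |(!![1, 0, 0; p, -1, 0; q, 0, -1] :
    Matrix (Fin 3) (Fin 3) ℝ).det| = 1 := by
  simp [Matrix.det_fin_three]

theorem vec3_ne_zero {v : Fin 3 → ℤ} (hv : v ≠ 0) : ¬ (v 0 = 0 ∧ v 1 = 0 ∧ v 2 = 0) := by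
  rintro ⟨h0, h1, h2⟩
  apply hv
  ext i
  fin_cases i <;> simpa

/-- Minkowski's theorem for one form in two variables. -/
theorem formBox_of_one_lt {p q A₁ A₂ B : ℝ} (h₁ : 0 < A₁) (h₂ : 0 < A₂) (hB : 0 < B)
    (h : 1 < A₁ * A₂ * B) : FormBox p q A₁ A₂ B := by
  obtain ⟨v, hv0, hv⟩ := exists_int_vec_of_abs_det_lt !![1, 0, 0; 0, 1, 0; p, q, -1]
    ![A₁, A₂, B] (by intro i; fin_cases i <;> simpa)
    (fun h0 => by have := abs_det_formMatrix p q; simp [h0] at this)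
    (by rw [abs_det_formMatrix]; simpa [Fin.prod_univ_three] using h)
  have e0 := hv 0
  have e1 := hv 1
  have e2 := hv 2
  simp [Matrix.mulVec, dotProduct, Fin.sum_univ_three] at e0 e1 e2
  exact ⟨v 0, v 1, v 2, vec3_ne_zero hv0, e0.le, e1.le, by simpa [sub_eq_add_neg] using e2.le⟩

/-- Minkowski's theorem for two forms in one variable. -/
theorem pointBox_of_one_lt {p q T B₁ B₂ : ℝ} (hT : 0 < T) (h₁ : 0 < B₁) (h₂ : 0 < B₂)
    (h : 1 < T * B₁ * B₂) : PointBox p q T B₁ B₂ := by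
  obtain ⟨v, hv0, hv⟩ := exists_int_vec_of_abs_det_lt !![1, 0, 0; p, -1, 0; q, 0, -1]
    ![T, B₁, B₂] (by intro i; fin_cases i <;> simpa)
    (fun h0 => by have := abs_det_pointMatrix p q; simp [h0] at this)
    (by rw [abs_det_pointMatrix]; simpa [Fin.prod_univ_three] using h)
  have e0 := hv 0
  have e1 := hv 1
  have e2 := hv 2
  simp [Matrix.mulVec, dotProduct, Fin.sum_univ_three] at e0 e1 e2
  exact ⟨v 0, v 1, v 2, vec3_ne_zero hv0, e0.le, by simpa [sub_eq_add_neg] using e1.le,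
    by simpa [sub_eq_add_neg] using e2.le⟩

/-- The dual point supplies the coefficients: with rows (1,0,0), (0,1,0), (p,q,−1), the combination
−(px − y₁), −(qx − y₂), x equals the integer vector (y₁, y₂, −x). -/
theorem formBox_of_compound {p q A₁ A₂ B : ℝ} (h₁ : 0 < A₁) (h₂ : 0 < A₂) (hB : 0 < B)
    {x y₁ y₂ : ℤ} (h0 : ¬ (x = 0 ∧ y₁ = 0 ∧ y₂ = 0)) (hx : |(x : ℝ)| ≤ A₁ * A₂)
    (hy₁ : |p * x - y₁| ≤ A₂ * B) (hy₂ : |q * x - y₂| ≤ A₁ * B) :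
    FormBox p q (4 * A₁) (4 * A₂) (4 * B) := by
  obtain ⟨v, hv0, hv⟩ := exists_int_vec_of_compound !![1, 0, 0; 0, 1, 0; p, q, -1]
    (abs_det_formMatrix p q) ![-(p * x - y₁), -(q * x - y₂), x] ![A₁, A₂, B] ![y₁, y₂, -x]
    (by
      intro h
      have e0 := congrFun h 0
      have e1 := congrFun h 1
      have e2 := congrFun h 2
      simp at e0 e1 e2
      subst e2
      simp at e0 e1
      exact h0 ⟨rfl, e0, e1⟩)
    (by intro i; fin_cases i <;> simpa)
    (by intro j; fin_cases j <;> simp [Fin.sum_univ_three] <;> ring)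
    (by
      intro i
      fin_cases i
      · simp only [Fin.zero_eta, Matrix.cons_val, abs_neg]
        nlinarith
      · simp only [Fin.mk_one, Matrix.cons_val, abs_neg]
        nlinarith
      · simp only [Fin.reduceFinMk, Matrix.cons_val]
        nlinarith)
  have e0 := hv 0
  have e1 := hv 1
  have e2 := hv 2
  simp [Matrix.mulVec, dotProduct, Fin.sum_univ_three] at e0 e1 e2
  exact ⟨v 0, v 1, v 2, vec3_ne_zero hv0, e0, e1, by simpa [sub_eq_add_neg] using e2⟩

theorem pointBox_of_compound {p q T B₁ B₂ : ℝ} (hT : 0 < T) (h₁ : 0 < B₁) (h₂ : 0 < B₂)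
    {x₁ x₂ y : ℤ} (h0 : ¬ (x₁ = 0 ∧ x₂ = 0 ∧ y = 0)) (hL : |p * x₁ + q * x₂ - y| ≤ B₁ * B₂)
    (hx₁ : |(x₁ : ℝ)| ≤ T * B₂) (hx₂ : |(x₂ : ℝ)| ≤ T * B₁) :
    PointBox p q (4 * T) (4 * B₁) (4 * B₂) := by
  obtain ⟨v, hv0, hv⟩ := exists_int_vec_of_compound !![1, 0, 0; p, -1, 0; q, 0, -1]
    (abs_det_pointMatrix p q) ![p * x₁ + q * x₂ - y, -x₁, -x₂] ![T, B₁, B₂] ![-y, x₁, x₂]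
    (by
      intro h
      have e0 := congrFun h 0
      have e1 := congrFun h 1
      have e2 := congrFun h 2
      simp at e0 e1 e2
      subst e1 e2
      simp at e0
      exact h0 ⟨rfl, rfl, e0⟩)
    (by intro i; fin_cases i <;> simpa)
    (by intro j; fin_cases j <;> simp [Fin.sum_univ_three] <;> ring)
    (by
      intro i
      fin_cases i
      · simp only [Fin.zero_eta, Matrix.cons_val]
        nlinarith
      · simp only [Fin.mk_one, Matrix.cons_val, abs_neg]
        nlinarith
      · simp only [Fin.reduceFinMk, Matrix.cons_val, abs_neg]
        nlinarith)
  have e0 := hv 0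
  have e1 := hv 1
  have e2 := hv 2
  simp [Matrix.mulVec, dotProduct, Fin.sum_univ_three] at e0 e1 e2
  exact ⟨v 0, v 1, v 2, vec3_ne_zero hv0, e0, by simpa [sub_eq_add_neg] using e1,
    by simpa [sub_eq_add_neg] using e2⟩

/-! ### From one form to two forms -/

theorem FormBox.exists_min {p q A₁ A₂ B : ℝ} (h : FormBox p q A₁ A₂ B) :
    ∃ x₁ x₂ y : ℤ, ¬ (x₁ = 0 ∧ x₂ = 0 ∧ y = 0) ∧ |(x₁ : ℝ)| ≤ A₁ ∧ |(x₂ : ℝ)| ≤ A₂ ∧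
      |p * x₁ + q * x₂ - y| ≤ B ∧
      ∀ x₁' x₂' y' : ℤ, ¬ (x₁' = 0 ∧ x₂' = 0 ∧ y' = 0) → |(x₁' : ℝ)| ≤ A₁ → |(x₂' : ℝ)| ≤ A₂ →
        |p * x₁ + q * x₂ - y| ≤ |p * x₁' + q * x₂' - y'| := by
  set S : Set (ℤ × ℤ × ℤ) := {z | ¬ (z.1 = 0 ∧ z.2.1 = 0 ∧ z.2.2 = 0) ∧ |(z.1 : ℝ)| ≤ A₁ ∧
    |(z.2.1 : ℝ)| ≤ A₂ ∧ |p * z.1 + q * z.2.1 - z.2.2| ≤ B} with hS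
  have mem_Icc : ∀ {n : ℤ} {R : ℝ}, |(n : ℝ)| ≤ R → n ∈ Set.Icc (-⌈R⌉) ⌈R⌉ := by
    intro n R hn
    have h1 : |n| ≤ ⌈R⌉ := by
      have := hn.trans (Int.le_ceil R)
      exact_mod_cast this
    exact ⟨by linarith [(abs_le.1 h1).1], (abs_le.1 h1).2⟩
  have hfin : S.Finite := by
    refine ((Set.finite_Icc (-⌈A₁⌉) ⌈A₁⌉).prod ((Set.finite_Icc (-⌈A₂⌉) ⌈A₂⌉).prod
      (Set.finite_Icc (-⌈|p| * A₁ + |q| * A₂ + B⌉) ⌈|p| * A₁ + |q| * A₂ + B⌉))).subset ?_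
    rintro ⟨x₁, x₂, y⟩ ⟨-, h1, h2, h3⟩
    refine ⟨mem_Icc h1, mem_Icc h2, mem_Icc ?_⟩
    simp only at h1 h2 h3 ⊢
    have e : (y : ℝ) = p * x₁ + q * x₂ - (p * x₁ + q * x₂ - y) := by ring
    rw [e]
    refine (abs_sub _ _).trans (add_le_add ((abs_add_le _ _).trans ?_) h3)
    rw [abs_mul, abs_mul]
    gcongr
  have hne : S.Nonempty := by
    obtain ⟨x₁, x₂, y, h0, h1, h2, h3⟩ := h
    exact ⟨(x₁, x₂, y), h0, h1, h2, h3⟩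
  obtain ⟨⟨x₁, x₂, y⟩, ⟨h0, h1, h2, h3⟩, hmin⟩ :=
    Set.exists_min_image S (fun z => |p * z.1 + q * z.2.1 - z.2.2|) hfin hne
  refine ⟨x₁, x₂, y, h0, h1, h2, h3, fun x₁' x₂' y' h0' h1' h2' => ?_⟩
  by_contra! hlt
  exact (hmin (x₁', x₂', y') ⟨h0', h1', h2', hlt.le.trans h3⟩).not_gt hlt

theorem two_mul_rpow_le {x s : ℝ} (hx : 0 ≤ x) (hs : s ≤ 1) : (2 * x) ^ s ≤ 2 * x ^ s := by
  rw [Real.mul_rpow (by norm_num) hx]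
  gcongr
  calc (2 : ℝ) ^ s ≤ 2 ^ (1 : ℝ) := Real.rpow_le_rpow_of_exponent_le (by norm_num) hs
    _ = 2 := Real.rpow_one 2

theorem abs_sub_le_of_abs_le {a b A B C : ℝ} (ha : |a| ≤ A) (hb : |b| ≤ B) (h : A + B ≤ C) :
    |a - b| ≤ C :=
  (abs_sub _ _).trans ((add_le_add ha hb).trans h)

/-- Uniform solvability for one form in two variables passes to two forms in one variable. -/
theorem pointBox_of_forall_formBox {p q s₁ s₂ α t₀ X : ℝ} (h₁ : s₁ ≤ 1) (h₂ : s₂ ≤ 1)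
    (h₁' : 0 < s₁) (h₂' : 0 < s₂) (hα : 1 ≤ α) (ht₀ : 1 ≤ t₀)
    (H : ∀ X, t₀ ≤ X → FormBox p q (X ^ s₁) (X ^ s₂) (X ^ (-α))) (hX : t₀ ≤ X) :
    PointBox p q (4 * X ^ α) (4 * X ^ (s₂ - α)) (4 * X ^ (s₁ - α)) := by
  have hX0 : 0 < X := by linarith
  have hT : 0 < X ^ α := Real.rpow_pos_of_pos hX0 _
  have hB₁ : 0 < X ^ (s₂ - α) := Real.rpow_pos_of_pos hX0 _
  have hB₂ : 0 < X ^ (s₁ - α) := Real.rpow_pos_of_pos hX0 _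
  have e₁ : X ^ s₁ = X ^ α * X ^ (s₁ - α) := by rw [← Real.rpow_add hX0]; ring_nf
  have e₂ : X ^ s₂ = X ^ α * X ^ (s₂ - α) := by rw [← Real.rpow_add hX0]; ring_nf
  obtain ⟨x₁, x₂, y, h0, hx₁, hx₂, hL, hmin⟩ := (H X hX).exists_min
  set L : ℝ := p * x₁ + q * x₂ - y with hLdef
  -- Below this threshold the minimal point lies in the compound of the target box, and one point
  -- suffices.
  by_cases hc : |L| ≤ X ^ (s₂ - α) * X ^ (s₁ - α)
  · exact pointBox_of_compound hT hB₁ hB₂ h0 hc (e₁ ▸ hx₁) (e₂ ▸ hx₂)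
  push Not at hc
  have hL0 : 0 < |L| := lt_trans (by positivity) hc
  have hα0 : 0 < α := by linarith
  set Y : ℝ := |L| ^ (-α⁻¹) with hY
  have hY0 : 0 < Y := Real.rpow_pos_of_pos hL0 _
  have hYα : Y ^ (-α) = |L| := by
    rw [hY, ← Real.rpow_mul hL0.le]
    simp [hα0.ne']
  have hXY : X ≤ Y := by
    by_contra! hlt
    have := Real.rpow_lt_rpow_of_neg hY0 hlt (show -α < 0 by linarith)
    linarith
  -- At Y itself only |L'| ≤ |L| would follow; doubling makes it strict at the cost of a factor 2 in
  -- the sides.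
  obtain ⟨x₁', x₂', y', h0', hx₁', hx₂', hL'⟩ := H (2 * Y) (by linarith)
  set L' : ℝ := p * x₁' + q * x₂' - y' with hLdef'
  have hlt : |L'| < |L| := by
    rw [← hYα]
    exact hL'.trans_lt (Real.rpow_lt_rpow_of_neg hY0 (by linarith) (by linarith))
  replace hx₁' := hx₁'.trans (two_mul_rpow_le hY0.le h₁)
  replace hx₂' := hx₂'.trans (two_mul_rpow_le hY0.le h₂)
  have f₁ : |L| * Y ^ s₁ ≤ X ^ (s₁ - α) := by
    rw [← hYα, ← Real.rpow_add hY0, neg_add_eq_sub]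
    exact Real.rpow_le_rpow_of_nonpos hX0 hXY (by linarith)
  have f₂ : |L| * Y ^ s₂ ≤ X ^ (s₂ - α) := by
    rw [← hYα, ← Real.rpow_add hY0, neg_add_eq_sub]
    exact Real.rpow_le_rpow_of_nonpos hX0 hXY (by linarith)
  have g₁ : X ^ s₁ ≤ Y ^ s₁ := Real.rpow_le_rpow hX0.le hXY h₁'.le
  have g₂ : X ^ s₂ ≤ Y ^ s₂ := Real.rpow_le_rpow hX0.le hXY h₂'.le
  have k₁ : |(x₁ : ℝ)| * Y ^ s₂ ≤ X ^ α := by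
    refine le_of_mul_le_mul_left ?_ hL0
    calc |L| * (|(x₁ : ℝ)| * Y ^ s₂) = |(x₁ : ℝ)| * (|L| * Y ^ s₂) := by ring
      _ ≤ (X ^ α * X ^ (s₁ - α)) * X ^ (s₂ - α) := by
        rw [← e₁]; gcongr
      _ = (X ^ (s₂ - α) * X ^ (s₁ - α)) * X ^ α := by ring
      _ ≤ |L| * X ^ α := by gcongr
  have k₂ : |(x₂ : ℝ)| * Y ^ s₁ ≤ X ^ α := by
    refine le_of_mul_le_mul_left ?_ hL0
    calc |L| * (|(x₂ : ℝ)| * Y ^ s₁) = |(x₂ : ℝ)| * (|L| * Y ^ s₁) := by ring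
      _ ≤ (X ^ α * X ^ (s₂ - α)) * X ^ (s₁ - α) := by
        rw [← e₂]; gcongr
      _ = (X ^ (s₂ - α) * X ^ (s₁ - α)) * X ^ α := by ring
      _ ≤ |L| * X ^ α := by gcongr
  have i₁ : p * ((x₁ * x₂' - x₂ * x₁' : ℤ) : ℝ) - ((y * x₂' - x₂ * y' : ℤ) : ℝ)
      = L * x₂' - x₂ * L' := by
    rw [hLdef, hLdef']; push_cast; ring
  have i₂ : q * ((x₁ * x₂' - x₂ * x₁' : ℤ) : ℝ) - ((x₁ * y' - y * x₁' : ℤ) : ℝ)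
      = x₁ * L' - L * x₁' := by
    rw [hLdef, hLdef']; push_cast; ring
  -- The cross product, up to order and signs. Were it zero, |L'| < |L| would make the second point
  -- no larger than the first, contradicting minimality of |L|.
  refine ⟨x₁ * x₂' - x₂ * x₁', y * x₂' - x₂ * y', x₁ * y' - y * x₁', ?_, ?_, ?_, ?_⟩
  · rintro ⟨z0, z1, z2⟩
    rw [z0, z1, Int.cast_zero, mul_zero, sub_zero] at i₁
    rw [z0, z2, Int.cast_zero, mul_zero, sub_zero] at i₂
    refine (hmin x₁' x₂' y' h0' ?_ ?_).not_gt hlt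
    · refine le_trans (le_of_mul_le_mul_left ?_ hL0) hx₁
      rw [← abs_mul, show L * x₁' = x₁ * L' by linarith, abs_mul, mul_comm]
      gcongr
    · refine le_trans (le_of_mul_le_mul_left ?_ hL0) hx₂
      rw [← abs_mul, show L * x₂' = x₂ * L' by linarith, abs_mul, mul_comm]
      gcongr
  · push_cast
    refine abs_sub_le_of_abs_le (A := |(x₁ : ℝ)| * (2 * Y ^ s₂)) (B := |(x₂ : ℝ)| * (2 * Y ^ s₁))
      ?_ ?_ (by linarith)
    · rw [abs_mul]; gcongr
    · rw [abs_mul]; gcongr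
  · rw [i₁]
    refine abs_sub_le_of_abs_le (A := |L| * (2 * Y ^ s₂)) (B := Y ^ s₂ * |L|) ?_ ?_ (by linarith)
    · rw [abs_mul]; gcongr
    · rw [abs_mul]
      exact mul_le_mul (hx₂.trans g₂) hlt.le (abs_nonneg _) (by positivity)
  · rw [i₂]
    refine abs_sub_le_of_abs_le (A := Y ^ s₁ * |L|) (B := |L| * (2 * Y ^ s₁)) ?_ ?_ (by linarith)
    · rw [abs_mul]
      exact mul_le_mul (hx₁.trans g₁) hlt.le (abs_nonneg _) (by positivity)
    · rw [abs_mul]; gcongr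

/-! ### From two forms to one form -/

theorem PointBox.exists_min {p q T B₁ B₂ : ℝ} (h : PointBox p q T B₁ B₂) :
    ∃ x y₁ y₂ : ℤ, ¬ (x = 0 ∧ y₁ = 0 ∧ y₂ = 0) ∧ |(x : ℝ)| ≤ T ∧ |p * x - y₁| ≤ B₁ ∧
      |q * x - y₂| ≤ B₂ ∧
      ∀ x' y₁' y₂' : ℤ, ¬ (x' = 0 ∧ y₁' = 0 ∧ y₂' = 0) → |p * x' - y₁'| ≤ B₁ →
        |q * x' - y₂'| ≤ B₂ → |(x : ℝ)| ≤ |(x' : ℝ)| := by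
  classical
  have hex : ∃ n : ℕ, ∃ x y₁ y₂ : ℤ, x.natAbs = n ∧ ¬ (x = 0 ∧ y₁ = 0 ∧ y₂ = 0) ∧
      |p * x - y₁| ≤ B₁ ∧ |q * x - y₂| ≤ B₂ := by
    obtain ⟨x, y₁, y₂, h0, -, h1, h2⟩ := h
    exact ⟨_, x, y₁, y₂, rfl, h0, h1, h2⟩
  obtain ⟨x, y₁, y₂, hx, h0, h1, h2⟩ := Nat.find_spec hex
  have hmin : ∀ x' y₁' y₂' : ℤ, ¬ (x' = 0 ∧ y₁' = 0 ∧ y₂' = 0) → |p * x' - y₁'| ≤ B₁ →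
      |q * x' - y₂'| ≤ B₂ → |(x : ℝ)| ≤ |(x' : ℝ)| := by
    intro x' y₁' y₂' h0' h1' h2'
    have h3 := Nat.find_min' hex ⟨x', y₁', y₂', rfl, h0', h1', h2'⟩
    rw [← hx] at h3
    have h4 : |x| ≤ |x'| := by
      rw [Int.abs_eq_natAbs, Int.abs_eq_natAbs]
      exact_mod_cast h3
    exact_mod_cast h4
  obtain ⟨x', y₁', y₂', h0', hT, h1', h2'⟩ := h
  exact ⟨x, y₁, y₂, h0, (hmin x' y₁' y₂' h0' h1' h2').trans hT, h1, h2, hmin⟩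

theorem mul_half_rpow_neg_le {x t u a : ℝ} (hx : 1 ≤ x) (hxt : x ≤ t) (ha : 0 ≤ a)
    (hu : 1 - u ≤ a) : x * (x / 2) ^ (-u) ≤ 2 ^ u * t ^ a := by
  have hx0 : 0 < x := by linarith
  rw [Real.div_rpow hx0.le (by norm_num), Real.rpow_neg (by norm_num : (0 : ℝ) ≤ 2), div_inv_eq_mul]
  calc x * (x ^ (-u) * 2 ^ u) = 2 ^ u * (x ^ (1 : ℝ) * x ^ (-u)) := by rw [Real.rpow_one]; ring
    _ = 2 ^ u * x ^ (1 - u) := by rw [← Real.rpow_add hx0, sub_eq_add_neg]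
    _ ≤ 2 ^ u * t ^ a := by
      gcongr
      exact (Real.rpow_le_rpow_of_exponent_le hx hu).trans (Real.rpow_le_rpow hx0.le hxt ha)

/-- Uniform solvability for two forms in one variable passes to one form in two variables. -/
theorem formBox_of_forall_pointBox {p q u₁ u₂ a₁ a₂ t₀ t : ℝ}
    (ha₁ : 0 ≤ a₁) (ha₂ : 0 ≤ a₂) (h₁ : 1 - u₂ ≤ a₁) (h₂ : 1 - u₁ ≤ a₂) (ht₀ : 1 ≤ t₀)
    (H : ∀ t, t₀ ≤ t → PointBox p q t (t ^ (-u₁)) (t ^ (-u₂))) (ht : t₀ ≤ t)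
    (ht' : 2 * t₀ ≤ t ^ (a₁ + a₂)) :
    FormBox p q ((4 + 2 ^ u₁ + 2 ^ u₂) * t ^ a₁) ((4 + 2 ^ u₁ + 2 ^ u₂) * t ^ a₂)
      ((4 + 2 ^ u₁ + 2 ^ u₂) * t⁻¹) := by
  have ht1 : 1 ≤ t := ht₀.trans ht
  have htp : 0 < t := by linarith
  have hA₁ : 0 < t ^ a₁ := Real.rpow_pos_of_pos htp _
  have hA₂ : 0 < t ^ a₂ := Real.rpow_pos_of_pos htp _
  have hB : 0 < t⁻¹ := inv_pos.2 htp
  have hK₁ : (0 : ℝ) < 2 ^ u₁ := by positivity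
  have hK₂ : (0 : ℝ) < 2 ^ u₂ := by positivity
  -- The errors are relaxed to those of the compound of the box with sides t ^ a₁, t ^ a₂, t⁻¹.
  have c₁ : t ^ (-u₁) ≤ t ^ a₂ * t⁻¹ := by
    rw [← Real.rpow_neg_one, ← Real.rpow_add htp]
    exact Real.rpow_le_rpow_of_exponent_le ht1 (by linarith)
  have c₂ : t ^ (-u₂) ≤ t ^ a₁ * t⁻¹ := by
    rw [← Real.rpow_neg_one, ← Real.rpow_add htp]
    exact Real.rpow_le_rpow_of_exponent_le ht1 (by linarith)
  obtain ⟨x, y₁, y₂, h0, hx, hξ₁, hξ₂, hmin⟩ := ((H t ht).mono le_rfl c₁ c₂).exists_min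
  by_cases hc : |(x : ℝ)| ≤ t ^ a₁ * t ^ a₂
  · exact (formBox_of_compound hA₁ hA₂ hB h0 hc hξ₁ hξ₂).mono (by gcongr; linarith)
      (by gcongr; linarith) (by gcongr; linarith)
  push Not at hc
  have hx2 : 2 * t₀ ≤ |(x : ℝ)| := by
    rw [← Real.rpow_add htp] at hc
    linarith
  have hx0 : 0 < |(x : ℝ)| := by linarith
  -- Halving gives |x'| < |x| strictly and costs the factors 2 ^ u₁ and 2 ^ u₂; the 4 in the
  -- constant belongs to the compound case.
  obtain ⟨x', y₁', y₂', h0', hx', hξ₁', hξ₂'⟩ := H (|(x : ℝ)| / 2) (by linarith)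
  have hlt : |(x' : ℝ)| < |(x : ℝ)| := by linarith
  set ξ₁ : ℝ := p * x - y₁ with d₁
  set ξ₂ : ℝ := q * x - y₂ with d₂
  set ξ₁' : ℝ := p * x' - y₁' with d₁'
  set ξ₂' : ℝ := q * x' - y₂' with d₂'
  have k₁ : |(x : ℝ)| * |ξ₁'| ≤ 2 ^ u₁ * t ^ a₂ :=
    (mul_le_mul_of_nonneg_left hξ₁' hx0.le).trans (mul_half_rpow_neg_le (by linarith) hx ha₂ h₂)
  have k₂ : |(x : ℝ)| * |ξ₂'| ≤ 2 ^ u₂ * t ^ a₁ :=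
    (mul_le_mul_of_nonneg_left hξ₂' hx0.le).trans (mul_half_rpow_neg_le (by linarith) hx ha₁ h₁)
  have l₁ : |ξ₁| * |(x' : ℝ)| ≤ t ^ a₂ := by
    calc |ξ₁| * |(x' : ℝ)| ≤ (t ^ a₂ * t⁻¹) * t := by
          gcongr
          exact hlt.le.trans hx
      _ = t ^ a₂ := by field_simp
  have l₂ : |ξ₂| * |(x' : ℝ)| ≤ t ^ a₁ := by
    calc |ξ₂| * |(x' : ℝ)| ≤ (t ^ a₁ * t⁻¹) * t := by
          gcongr
          exact hlt.le.trans hx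
      _ = t ^ a₁ := by field_simp
  have m₁ : |ξ₁| * |ξ₂'| ≤ 2 ^ u₂ * t⁻¹ := by
    refine le_of_mul_le_mul_left ?_ hA₁
    calc t ^ a₁ * (|ξ₁| * |ξ₂'|) ≤ t ^ a₁ * ((t ^ a₂ * t⁻¹) * |ξ₂'|) := by gcongr
      _ = (t ^ a₁ * t ^ a₂) * |ξ₂'| * t⁻¹ := by ring
      _ ≤ |(x : ℝ)| * |ξ₂'| * t⁻¹ := by gcongr
      _ ≤ (2 ^ u₂ * t ^ a₁) * t⁻¹ := by gcongr
      _ = t ^ a₁ * (2 ^ u₂ * t⁻¹) := by ring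
  have m₂ : |ξ₂| * |ξ₁'| ≤ 2 ^ u₁ * t⁻¹ := by
    refine le_of_mul_le_mul_left ?_ hA₂
    calc t ^ a₂ * (|ξ₂| * |ξ₁'|) ≤ t ^ a₂ * ((t ^ a₁ * t⁻¹) * |ξ₁'|) := by gcongr
      _ = (t ^ a₁ * t ^ a₂) * |ξ₁'| * t⁻¹ := by ring
      _ ≤ |(x : ℝ)| * |ξ₁'| * t⁻¹ := by gcongr
      _ ≤ (2 ^ u₁ * t ^ a₂) * t⁻¹ := by gcongr
      _ = t ^ a₂ * (2 ^ u₁ * t⁻¹) := by ring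
  have i₁ : ((x * y₂' - y₂ * x' : ℤ) : ℝ) = ξ₂ * x' - x * ξ₂' := by
    rw [d₂, d₂']; push_cast; ring
  have i₂ : ((y₁ * x' - x * y₁' : ℤ) : ℝ) = x * ξ₁' - ξ₁ * x' := by
    rw [d₁, d₁']; push_cast; ring
  have i₃ : p * ((x * y₂' - y₂ * x' : ℤ) : ℝ) + q * ((y₁ * x' - x * y₁' : ℤ) : ℝ)
      - ((y₁ * y₂' - y₂ * y₁' : ℤ) : ℝ) = ξ₂ * ξ₁' - ξ₁ * ξ₂' := by
    rw [d₁, d₁', d₂, d₂']; push_cast; ring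
  refine ⟨x * y₂' - y₂ * x', y₁ * x' - x * y₁', y₁ * y₂' - y₂ * y₁', ?_, ?_, ?_, ?_⟩
  · rintro ⟨z0, z1, -⟩
    rw [z0, Int.cast_zero] at i₁
    rw [z1, Int.cast_zero] at i₂
    -- Two vanishing minors already give x ξᵢ' = x' ξᵢ, so the second point has no larger errors but
    -- smaller |x'|.
    refine (hmin x' y₁' y₂' h0' ?_ ?_).not_gt hlt
    · refine le_trans (le_of_mul_le_mul_left ?_ hx0) hξ₁
      rw [← abs_mul, show (x : ℝ) * ξ₁' = x' * ξ₁ by linarith, abs_mul]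
      gcongr
    · refine le_trans (le_of_mul_le_mul_left ?_ hx0) hξ₂
      rw [← abs_mul, show (x : ℝ) * ξ₂' = x' * ξ₂ by linarith, abs_mul]
      gcongr
  · rw [i₁]
    refine abs_sub_le_of_abs_le ((abs_mul _ _).le.trans l₂) ((abs_mul _ _).le.trans k₂) ?_
    linarith [mul_pos hK₁ hA₁]
  · rw [i₂]
    refine abs_sub_le_of_abs_le ((abs_mul _ _).le.trans k₁) ((abs_mul _ _).le.trans l₁) ?_
    linarith [mul_pos hK₂ hA₂]
  · rw [i₃]
    refine abs_sub_le_of_abs_le ((abs_mul _ _).le.trans m₂) ((abs_mul _ _).le.trans m₁) ?_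
    linarith

/-! ### Transfers for large parameters -/

theorem eventually_const_mul_rpow_le (C : ℝ) {a b : ℝ} (h : a < b) :
    ∀ᶠ t : ℝ in atTop, C * t ^ a ≤ t ^ b := by
  filter_upwards [(tendsto_rpow_atTop (sub_pos.2 h)).eventually_ge_atTop C,
    eventually_gt_atTop 0] with t ht ht0
  calc C * t ^ a ≤ t ^ (b - a) * t ^ a := by gcongr
    _ = t ^ b := by rw [← Real.rpow_add ht0]; ring_nf

theorem tendsto_div_rpow_atTop {c r : ℝ} (hc : 0 < c) (hr : 0 < r) :
    Tendsto (fun t : ℝ => (t / c) ^ r) atTop atTop :=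
  (tendsto_rpow_atTop hr).comp (tendsto_id.atTop_div_const hc)

/-- Substitute X = (t/4) ^ α⁻¹, so that 4 X ^ α = t; the strict bounds on b₁, b₂ absorb the
remaining constants. -/
theorem eventually_pointBox_of_eventually_formBox {p q s₁ s₂ α b₁ b₂ : ℝ} (h₁ : s₁ ≤ 1)
    (h₂ : s₂ ≤ 1) (h₁' : 0 < s₁) (h₂' : 0 < s₂) (hα : 1 ≤ α)
    (H : ∀ᶠ t : ℝ in atTop, FormBox p q (t ^ s₁) (t ^ s₂) (t ^ (-α)))
    (hb₁ : b₁ < 1 - s₂ / α) (hb₂ : b₂ < 1 - s₁ / α) :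
    ∀ᶠ t : ℝ in atTop, PointBox p q t (t ^ (-b₁)) (t ^ (-b₂)) := by
  obtain ⟨t₁, ht₁⟩ := eventually_atTop.1 H
  have hα0 : 0 < α := by linarith
  have key : ∀ {s b : ℝ}, b < 1 - s / α →
      ∀ᶠ t : ℝ in atTop, 4 * ((t / 4) ^ α⁻¹) ^ (s - α) ≤ t ^ (-b) := by
    intro s b hb
    filter_upwards [eventually_const_mul_rpow_le (4 * ((4 : ℝ) ^ (α⁻¹ * (s - α)))⁻¹)
      (show α⁻¹ * (s - α) < -b by
        have : α⁻¹ * (s - α) = s / α - 1 := by field_simp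
        linarith), eventually_gt_atTop 0] with t ht ht0
    rw [← Real.rpow_mul (by positivity), Real.div_rpow ht0.le (by norm_num)]
    calc _ = _ := by ring
      _ ≤ _ := ht
  filter_upwards [key hb₁, key hb₂, eventually_gt_atTop 0,
    (tendsto_div_rpow_atTop (show (0 : ℝ) < 4 by norm_num)
      (inv_pos.2 hα0)).eventually_ge_atTop (max t₁ 1)] with t k₁ k₂ ht0 ht
  refine (pointBox_of_forall_formBox h₁ h₂ h₁' h₂' hα (le_max_right t₁ 1)
    (fun X hX => ht₁ X ((le_max_left _ _).trans hX)) ht).mono ?_ k₁ k₂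
  rw [← Real.rpow_mul (by positivity), inv_mul_cancel₀ hα0.ne', Real.rpow_one]
  linarith

/-- The dual parameter is (t/D) ^ α. Choosing D ^ s₂ = C absorbs the constant in both sides, as C ≥
1 and s₂ ≤ s₁; the gap between α' and α absorbs it in the form. -/
theorem eventually_formBox_of_eventually_pointBox {p q s₁ s₂ u₁ u₂ α α' : ℝ} (h₂ : 0 < s₂)
    (h₁₂ : s₂ ≤ s₁) (hα : 0 < α) (hu₂ : 1 - u₂ ≤ s₁ / α) (hu₁ : 1 - u₁ ≤ s₂ / α) (hα' : α' < α)
    (H : ∀ᶠ t : ℝ in atTop, PointBox p q t (t ^ (-u₁)) (t ^ (-u₂))) :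
    ∀ᶠ t : ℝ in atTop, FormBox p q (t ^ s₁) (t ^ s₂) (t ^ (-α')) := by
  obtain ⟨t₁, ht₁⟩ := eventually_atTop.1 H
  have h₁ : 0 < s₁ := h₂.trans_le h₁₂
  set t₀ : ℝ := max t₁ 1 with ht₀
  set C : ℝ := 4 + 2 ^ u₁ + 2 ^ u₂ with hC
  have hC1 : 1 ≤ C := by
    have e₁ : (0 : ℝ) < 2 ^ u₁ := by positivity
    have e₂ : (0 : ℝ) < 2 ^ u₂ := by positivity
    linarith
  have hC0 : 0 < C := by linarith
  set D : ℝ := C ^ s₂⁻¹ with hD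
  have hD0 : 0 < D := Real.rpow_pos_of_pos hC0 _
  have hD₂ : C ≤ D ^ s₂ := by
    rw [hD, ← Real.rpow_mul hC0.le, inv_mul_cancel₀ h₂.ne', Real.rpow_one]
  have hD₁ : C ≤ D ^ s₁ := by
    refine hD₂.trans (Real.rpow_le_rpow_of_exponent_le ?_ h₁₂)
    exact Real.one_le_rpow hC1 (inv_nonneg.2 h₂.le)
  have side : ∀ {s t : ℝ}, 0 < t → C ≤ D ^ s → C * ((t / D) ^ α) ^ (s / α) ≤ t ^ s := by
    intro s t ht hs
    rw [← Real.rpow_mul (by positivity), mul_div_cancel₀ _ hα.ne', Real.div_rpow ht.le hD0.le,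
      ← mul_div_assoc, div_le_iff₀ (by positivity), mul_comm]
    gcongr
  have ht := tendsto_div_rpow_atTop hD0 hα
  filter_upwards [ht.eventually_ge_atTop t₀, eventually_gt_atTop 0,
    ((tendsto_rpow_atTop (show 0 < s₁ / α + s₂ / α by positivity)).comp ht).eventually_ge_atTop
      (2 * t₀),
    eventually_const_mul_rpow_le (C * D ^ α) (neg_lt_neg hα')] with t k₁ ht0 k₂ k₃
  refine (formBox_of_forall_pointBox (div_pos h₁ hα).le (div_pos h₂ hα).le hu₂ hu₁
    (le_max_right t₁ 1) (fun X hX => ht₁ X ((le_max_left _ _).trans hX)) k₁ k₂).mono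
    (side ht0 hD₁) (side ht0 hD₂) (le_trans (le_of_eq ?_) k₃)
  rw [Real.div_rpow ht0.le hD0.le, inv_div, Real.rpow_neg ht0.le]
  ring

theorem eventually_formBox {p q s₁ s₂ γ : ℝ} (hs : s₁ + s₂ = 1) (hγ : γ < 1) :
    ∀ᶠ t : ℝ in atTop, FormBox p q (t ^ s₁) (t ^ s₂) (t ^ (-γ)) := by
  filter_upwards [eventually_gt_atTop 1] with t ht
  have ht0 : 0 < t := by linarith
  refine formBox_of_one_lt (by positivity) (by positivity) (by positivity) ?_
  rw [← Real.rpow_add ht0, ← Real.rpow_add ht0, hs]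
  exact Real.one_lt_rpow ht (by linarith)

theorem eventually_pointBox {p q s₁ s₂ γ : ℝ} (hs : s₁ + s₂ = 1) (hγ : γ < 1) :
    ∀ᶠ t : ℝ in atTop, PointBox p q t (t ^ (-(γ * s₁))) (t ^ (-(γ * s₂))) := by
  filter_upwards [eventually_gt_atTop 1] with t ht
  have ht0 : 0 < t := by linarith
  refine pointBox_of_one_lt ht0 (by positivity) (by positivity) ?_
  nth_rewrite 1 [← Real.rpow_one t]
  rw [← Real.rpow_add ht0, ← Real.rpow_add ht0]
  refine Real.one_lt_rpow ht ?_
  have : γ * s₁ + γ * s₂ = γ := by rw [← mul_add, hs, mul_one]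
  linarith

/-! ### Irrationality bounds the dual exponent -/

/-- The uniform exponent of approximation to one irrational number is at most `1`. -/
theorem Irrational.le_one_of_eventually_approx {θ δ : ℝ} (hθ : Irrational θ)
    (H : ∀ᶠ t : ℝ in atTop, ∃ x y : ℤ, x ≠ 0 ∧ |(x : ℝ)| ≤ t ∧ |θ * x - y| ≤ t ^ (-δ)) :
    δ ≤ 1 := by
  by_contra! hδ
  have hsmall : ∀ᶠ t : ℝ in atTop, 4 * t ^ (1 - δ) ≤ t ^ (0 : ℝ) :=
    eventually_const_mul_rpow_le 4 (by linarith)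
  obtain ⟨t₀, ht₀⟩ := eventually_atTop.1 ((H.and hsmall).and (eventually_ge_atTop 1))
  have h1 : 1 ≤ t₀ := (ht₀ t₀ le_rfl).2
  have hge : ∀ n : ℕ, t₀ ≤ t₀ * 2 ^ n := fun n =>
    le_mul_of_one_le_right (by linarith) (one_le_pow₀ (by norm_num))
  choose x y hx0 hx hξ using fun n : ℕ => (ht₀ _ (hge n)).1.1
  -- The determinant of the solutions at t and 2t is an integer of size at most 3 t ^ (1 - δ) < 1,
  -- hence zero.
  have step : ∀ n, x n * y (n + 1) = x (n + 1) * y n := by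
    intro n
    set t : ℝ := t₀ * 2 ^ n with ht
    have hn := (ht₀ t (hge n)).1.2
    have htp : 0 < t := by linarith [hge n]
    have h2t : t₀ * 2 ^ (n + 1) = 2 * t := by rw [ht]; ring
    have hx' := hx (n + 1)
    have hξ' := hξ (n + 1)
    rw [h2t] at hx' hξ'
    have hξ'' : |θ * x (n + 1) - y (n + 1)| ≤ t ^ (-δ) :=
      hξ'.trans (Real.rpow_le_rpow_of_nonpos htp (by linarith) (by linarith))
    have e : ((x (n + 1) * y n - x n * y (n + 1) : ℤ) : ℝ)
        = x n * (θ * x (n + 1) - y (n + 1)) - x (n + 1) * (θ * x n - y n) := by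
      push_cast; ring
    have hpow : t * t ^ (-δ) = t ^ (1 - δ) := by
      nth_rewrite 1 [← Real.rpow_one t]
      rw [← Real.rpow_add htp, sub_eq_add_neg]
    have hlt : |((x (n + 1) * y n - x n * y (n + 1) : ℤ) : ℝ)| < 1 := by
      rw [e]
      have hpos : 0 < t ^ (1 - δ) := Real.rpow_pos_of_pos htp _
      rw [Real.rpow_zero] at hn
      refine (abs_sub_le_of_abs_le (A := t * t ^ (-δ)) (B := 2 * t * t ^ (-δ)) (C := 3 * t ^ (1 - δ))
        ?_ ?_ ?_).trans_lt (by linarith)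
      · rw [abs_mul]; gcongr; exact hx n
      · rw [abs_mul]; gcongr; exact hξ n
      · rw [← hpow]; linarith
    have h0 := Int.abs_lt_one_iff.1 (show |x (n + 1) * y n - x n * y (n + 1)| < 1 by exact_mod_cast hlt)
    linarith
  have ratio : ∀ n, x 0 * y n = x n * y 0 := by
    intro n
    induction n with
    | zero => rfl
    | succ n ih =>
      refine mul_left_cancel₀ (hx0 n) ?_
      calc x n * (x 0 * y (n + 1)) = x 0 * (x n * y (n + 1)) := by ring
        _ = x (n + 1) * (x 0 * y n) := by rw [step n]; ring
        _ = x n * (x (n + 1) * y 0) := by rw [ih]; ring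
  have hbound : ∀ n : ℕ, |θ * x 0 - y 0| ≤ |(x 0 : ℝ)| * (t₀ * 2 ^ n) ^ (-δ) := by
    intro n
    have e : (x n : ℝ) * (θ * x 0 - y 0) = x 0 * (θ * x n - y n) := by
      have := ratio n
      have h' : (x 0 : ℝ) * y n = x n * y 0 := by exact_mod_cast this
      linear_combination h'
    have hxn : 1 ≤ |(x n : ℝ)| := by exact_mod_cast Int.one_le_abs (hx0 n)
    calc |θ * x 0 - y 0| ≤ |(x n : ℝ)| * |θ * x 0 - y 0| :=
          le_mul_of_one_le_left (abs_nonneg _) hxn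
      _ = |(x 0 : ℝ)| * |θ * x n - y n| := by rw [← abs_mul, e, abs_mul]
      _ ≤ _ := by gcongr; exact hξ n
  have hlim : Tendsto (fun n : ℕ => |(x 0 : ℝ)| * (t₀ * 2 ^ n) ^ (-δ)) atTop (nhds 0) := by
    have h2 : Tendsto (fun n : ℕ => t₀ * (2 : ℝ) ^ n) atTop atTop :=
      (tendsto_pow_atTop_atTop_of_one_lt (by norm_num)).const_mul_atTop (by linarith)
    simpa using ((tendsto_rpow_neg_atTop (show 0 < δ by linarith)).comp h2).const_mul |(x 0 : ℝ)|
  have hz : θ * x 0 - y 0 = 0 := abs_eq_zero.1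
    (le_antisymm (ge_of_tendsto' hlim hbound) (abs_nonneg _))
  refine hθ ⟨(y 0 : ℚ) / x 0, ?_⟩
  have hxr : (x 0 : ℝ) ≠ 0 := by exact_mod_cast hx0 0
  push_cast
  rw [div_eq_iff hxr]
  linarith

theorem PointBox.exists_ne_zero {p q T B₁ B₂ : ℝ} (h : PointBox p q T B₁ B₂) (h₁ : B₁ < 1)
    (h₂ : B₂ < 1) : ∃ x y₁ y₂ : ℤ, x ≠ 0 ∧ |(x : ℝ)| ≤ T ∧ |p * x - y₁| ≤ B₁ ∧
      |q * x - y₂| ≤ B₂ := by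
  obtain ⟨x, y₁, y₂, h0, hT, hB₁, hB₂⟩ := h
  refine ⟨x, y₁, y₂, ?_, hT, hB₁, hB₂⟩
  rintro rfl
  rw [Int.cast_zero, mul_zero, zero_sub, abs_neg] at hB₁ hB₂
  refine h0 ⟨rfl, Int.abs_lt_one_iff.1 ?_, Int.abs_lt_one_iff.1 ?_⟩
  · exact_mod_cast hB₁.trans_lt h₁
  · exact_mod_cast hB₂.trans_lt h₂

theorem le_one_of_eventually_pointBox {p q u₁ u₂ : ℝ} (h₁ : 0 < u₁) (h₂ : 0 < u₂)
    (H : ∀ᶠ t : ℝ in atTop, PointBox p q t (t ^ (-u₁)) (t ^ (-u₂))) :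
    (Irrational p → u₁ ≤ 1) ∧ (Irrational q → u₂ ≤ 1) := by
  have H' : ∀ᶠ t : ℝ in atTop, ∃ x y₁ y₂ : ℤ, x ≠ 0 ∧ |(x : ℝ)| ≤ t ∧
      |p * x - y₁| ≤ t ^ (-u₁) ∧ |q * x - y₂| ≤ t ^ (-u₂) := by
    filter_upwards [H, eventually_gt_atTop 1] with t ht ht1
    exact ht.exists_ne_zero (Real.rpow_lt_one_of_one_lt_of_neg ht1 (by linarith))
      (Real.rpow_lt_one_of_one_lt_of_neg ht1 (by linarith))
  refine ⟨fun hp => hp.le_one_of_eventually_approx ?_, fun hq => hq.le_one_of_eventually_approx ?_⟩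
  · filter_upwards [H'] with t ⟨x, y₁, y₂, h0, hx, ha, hb⟩
    exact ⟨x, y₁, h0, hx, ha⟩
  · filter_upwards [H'] with t ⟨x, y₁, y₂, h0, hx, ha, hb⟩
    exact ⟨x, y₂, h0, hx, hb⟩

/-! ### Weighted norms in terms of boxes -/

theorem weightedNorm_le_iff {k : ℕ} {w z : Fin k → ℝ} {t : ℝ} (hw : ∀ i, 0 < w i) (ht : 0 ≤ t) :
    weightedNorm w z ≤ t ↔ ∀ i, |z i| ≤ t ^ w i := by
  have h : ∀ i, |z i| ^ (1 / w i) ≤ t ↔ |z i| ≤ t ^ w i := fun i => by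
    rw [one_div, Real.rpow_inv_le_iff_of_pos (abs_nonneg _) ht (hw i)]
  unfold weightedNorm
  refine ⟨fun hle i => (h i).1 ((le_ciSup (f := fun i => |z i| ^ (1 / w i))
    (Set.finite_range _).bddAbove i).trans hle), fun hle => Real.iSup_le (fun i => (h i).2 (hle i)) ht⟩

theorem hasNonzeroSolution_iff_formBox {σ : Fin 2 → ℝ} {ρ : Fin 1 → ℝ} (hσ : ∀ i, 0 < σ i)
    (hρ : ρ 0 = 1) (Θ : Matrix (Fin 1) (Fin 2) ℝ) {γ t : ℝ} (ht : 0 < t) :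
    HasNonzeroSolution σ ρ Θ γ t ↔
      FormBox (Θ 0 0) (Θ 0 1) (t ^ σ 0) (t ^ σ 1) (t ^ (-γ)) := by
  have hρ' : ∀ i, 0 < ρ i := fun i => by rw [Subsingleton.elim i 0, hρ]; norm_num
  unfold HasNonzeroSolution FormBox
  simp only [weightedNorm_le_iff hσ ht.le, weightedNorm_le_iff hρ' (Real.rpow_pos_of_pos ht _).le,
    Fin.forall_fin_two, Fin.forall_fin_one, hρ, Real.rpow_one, Matrix.mulVec, dotProduct,
    Fin.sum_univ_two]
  constructor
  · rintro ⟨x, y, h0, ⟨h1, h2⟩, h3⟩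
    refine ⟨x 0, x 1, y 0, fun ⟨e0, e1, e2⟩ => h0 ?_, h1, h2, h3⟩
    ext i <;> fin_cases i <;> simpa
  · rintro ⟨x₁, x₂, y, h0, h1, h2, h3⟩
    refine ⟨![x₁, x₂], ![y], fun e => h0 ?_, ⟨by simpa, by simpa⟩, by simpa⟩
    rw [Prod.mk.injEq] at e
    exact ⟨congrFun e.1 0, congrFun e.1 1, congrFun e.2 0⟩

theorem hasNonzeroSolution_iff_pointBox {σ : Fin 2 → ℝ} {ρ : Fin 1 → ℝ} (hσ : ∀ i, 0 < σ i)
    (hρ : ρ 0 = 1) (Θ : Matrix (Fin 1) (Fin 2) ℝ) {γ t : ℝ} (ht : 0 < t) :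
    HasNonzeroSolution ρ σ Θ.transpose γ t ↔
      PointBox (Θ 0 0) (Θ 0 1) t (t ^ (-(γ * σ 0))) (t ^ (-(γ * σ 1))) := by
  have hρ' : ∀ i, 0 < ρ i := fun i => by rw [Subsingleton.elim i 0, hρ]; norm_num
  unfold HasNonzeroSolution PointBox
  simp only [weightedNorm_le_iff hσ (Real.rpow_pos_of_pos ht _).le, weightedNorm_le_iff hρ' ht.le,
    Fin.forall_fin_two, Fin.forall_fin_one, hρ, Real.rpow_one, Matrix.mulVec, dotProduct,
    Fin.sum_univ_one, Matrix.transpose_apply, ← Real.rpow_mul ht.le, neg_mul]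
  constructor
  · rintro ⟨x, y, h0, h1, h2, h3⟩
    refine ⟨x 0, y 0, y 1, fun ⟨e0, e1, e2⟩ => h0 ?_, h1, h2, h3⟩
    ext i <;> fin_cases i <;> simpa
  · rintro ⟨x, y₁, y₂, h0, h1, h2, h3⟩
    refine ⟨![x], ![y₁, y₂], fun e => h0 ?_, by simpa, by simpa, by simpa⟩
    rw [Prod.mk.injEq] at e
    exact ⟨congrFun e.1 0, congrFun e.2 0, congrFun e.2 1⟩

/-! ### Passage to suprema -/

theorem EReal.le_sSup_coe_image_of_forall_lt {S : Set ℝ} {a : ℝ} (h : ∀ x < a, x ∈ S) :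
    (a : EReal) ≤ sSup ((fun x : ℝ => (x : EReal)) '' S) := by
  refine le_of_forall_lt fun c hc => ?_
  obtain ⟨x, hcx, hxa⟩ := EReal.lt_iff_exists_real_btwn.1 hc
  exact hcx.trans_le (le_sSup ⟨x, h x (EReal.coe_lt_coe_iff.1 hxa), rfl⟩)

theorem EReal.exists_mem_lt_of_lt_sSup_coe_image {S : Set ℝ} {a : ℝ}
    (h : (a : EReal) < sSup ((fun x : ℝ => (x : EReal)) '' S)) : ∃ x ∈ S, a < x := by
  obtain ⟨_, ⟨x, hx, rfl⟩, hax⟩ := lt_sSup_iff.1 h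
  exact ⟨x, hx, EReal.coe_lt_coe_iff.1 hax⟩

/-- If the conclusion failed, some α in S would exceed s₂ / (1 - s₁ v), against `hS`. Since α must
also exceed 1, W = 1 is separate; there v ≥ 1 suffices. -/
theorem one_le_add_of_transfer {S : Set ℝ} {s₁ s₂ v : ℝ} (h₁ : 0 < s₁) (h₂ : 0 < s₂)
    (hs : s₁ + s₂ = 1) (hv : 1 ≤ v) {W : EReal}
    (hW : W = sSup ((fun x : ℝ => (x : EReal)) '' S)) (hW1 : 1 ≤ W)
    (hS : ∀ α ∈ S, 1 ≤ α → 1 ≤ s₁ * v + s₂ / α) :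
    (1 : EReal) ≤ (s₁ : EReal) * v + s₂ * W⁻¹ := by
  induction W with
  | bot => exact absurd hW1 (not_le.2 (EReal.bot_lt_coe 1))
  | top =>
    rw [EReal.inv_top, mul_zero, add_zero]
    have : 1 ≤ s₁ * v := by
      by_contra! hlt
      obtain ⟨α, hα, hlt'⟩ := EReal.exists_mem_lt_of_lt_sSup_coe_image
        (a := max 1 (s₂ / (1 - s₁ * v))) (by rw [← hW]; exact EReal.coe_lt_top _)
      have h1α := ((le_max_left _ _).trans hlt'.le)
      have := hS α hα h1α
      have h3 := (le_max_right _ _).trans_lt hlt'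
      rw [div_lt_iff₀ (by linarith), mul_comm, ← div_lt_iff₀ (by linarith)] at h3
      linarith
    exact_mod_cast this
  | coe w =>
    have hw1 : 1 ≤ w := by exact_mod_cast hW1
    have : 1 ≤ s₁ * v + s₂ * w⁻¹ := by
      rw [← div_eq_mul_inv]
      rcases hw1.eq_or_lt with rfl | hw
      · nlinarith
      by_contra! hlt
      have hpos : 0 < s₂ / w := by positivity
      obtain ⟨α, hα, hlt'⟩ := EReal.exists_mem_lt_of_lt_sSup_coe_image
        (a := max 1 (s₂ / (1 - s₁ * v))) (by
          rw [← hW, EReal.coe_lt_coe_iff]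
          refine max_lt hw ?_
          rw [div_lt_iff₀ (by linarith), mul_comm, ← div_lt_iff₀ (by linarith)]
          linarith)
      have h1α := ((le_max_left _ _).trans hlt'.le)
      have := hS α hα h1α
      have h3 := (le_max_right _ _).trans_lt hlt'
      rw [div_lt_iff₀ (by linarith), mul_comm, ← div_lt_iff₀ (by linarith)] at h3
      linarith
    rw [← EReal.coe_inv]
    exact_mod_cast this

/-- Here γ approaches v from below, which keeps s₂ γ < 1 even if s₂ v = 1. No γ fits between 1 and v
when v = 1; then W ≥ 1 suffices. -/
theorem add_le_one_of_transfer {U : Set ℝ} {s₁ s₂ v : ℝ} (h₁ : 0 < s₁) (h₂ : 0 < s₂)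
    (hs : s₁ + s₂ = 1) (hv : 1 ≤ v) (hv' : s₂ * v ≤ 1) (hU : ∀ γ < v, γ ∈ U)
    {W : EReal} (hW1 : 1 ≤ W)
    (hUW : ∀ γ ∈ U, 1 ≤ γ → s₂ * γ < 1 → ((s₁ / (1 - s₂ * γ) : ℝ) : EReal) ≤ W) :
    (s₂ : EReal) * v + s₁ * W⁻¹ ≤ 1 := by
  induction W with
  | bot => exact absurd hW1 (not_le.2 (EReal.bot_lt_coe 1))
  | top =>
    rw [EReal.inv_top, mul_zero, add_zero]
    exact_mod_cast hv'
  | coe w =>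
    have hw1 : 1 ≤ w := by exact_mod_cast hW1
    have hw0 : 0 < w := by linarith
    have : s₂ * v + s₁ * w⁻¹ ≤ 1 := by
      rw [← div_eq_mul_inv]
      have hle : s₁ / w ≤ s₁ := div_le_self h₁.le hw1
      rcases hv.eq_or_lt with rfl | hv1
      · linarith
      by_contra! hlt
      obtain ⟨γ, hγ, hγv⟩ := exists_between (show max 1 ((1 - s₁ / w) / s₂) < v by
        refine max_lt hv1 ?_
        rw [div_lt_iff₀ h₂]
        linarith)
      have hγ' : s₂ * γ < 1 := by nlinarith
      have h3 := (le_max_right _ _).trans_lt hγ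
      rw [div_lt_iff₀ h₂] at h3
      have h4 := hUW γ (hU γ hγv) ((le_max_left _ _).trans hγ.le) hγ'
      rw [EReal.coe_le_coe_iff, div_le_iff₀ (by linarith), mul_comm, ← div_le_iff₀ hw0] at h4
      linarith
    rw [← EReal.coe_inv]
    exact_mod_cast this

/-! ### The transference theorem -/

theorem mainTheorem12 (σ : Fin 2 → ℝ) (ρ : Fin 1 → ℝ)
    (hσ : IsWeightVector σ) (hρ : IsWeightVector ρ)
    (Θ : Matrix (Fin 1) (Fin 2) ℝ)
    (hΘ : ¬ ∃ Q : Matrix (Fin 1) (Fin 2) ℚ, Θ = Q.map (fun q : ℚ => (q : ℝ))) :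
    (σ 0 : EReal) * uniformWeightedExponent ρ σ Θ.transpose
        + (σ 1 : EReal) * (uniformWeightedExponent σ ρ Θ)⁻¹ ≥ 1 ∧
    (σ 1 : EReal) * uniformWeightedExponent ρ σ Θ.transpose
        + (σ 0 : EReal) * (uniformWeightedExponent σ ρ Θ)⁻¹ ≤ 1 ∧
    (Irrational (Θ 0 0) →
      (σ 0 : EReal) * uniformWeightedExponent ρ σ Θ.transpose ≤ 1) := by
  obtain ⟨hpos, hanti, hsum⟩ := hσ
  have hρ1 : ρ 0 = 1 := by simpa using hρ.2.2
  have h₁ := hpos 0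
  have h₂ := hpos 1
  have h₂₁ : σ 1 ≤ σ 0 := hanti (by simp)
  have hs : σ 0 + σ 1 = 1 := by simpa [Fin.sum_univ_two] using hsum
  set p := Θ 0 0 with hp
  set q := Θ 0 1 with hq
  have hirr : Irrational p ∨ Irrational q := by
    by_contra! hcon
    obtain ⟨⟨a, ha⟩, ⟨b, hb⟩⟩ : (∃ a : ℚ, (a : ℝ) = p) ∧ (∃ b : ℚ, (b : ℝ) = q) := by
      simpa [Irrational] using hcon
    refine hΘ ⟨!![a, b], ?_⟩
    ext i j
    fin_cases i
    fin_cases j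
    · simp [ha, hp]
    · simp [hb, hq]
  set S : Set ℝ := {γ | ∀ᶠ t : ℝ in atTop, FormBox p q (t ^ σ 0) (t ^ σ 1) (t ^ (-γ))} with hS
  set U : Set ℝ := {γ | ∀ᶠ t : ℝ in atTop,
    PointBox p q t (t ^ (-(γ * σ 0))) (t ^ (-(γ * σ 1)))} with hU
  have hW : uniformWeightedExponent σ ρ Θ = sSup ((fun x : ℝ => (x : EReal)) '' S) := by
    unfold uniformWeightedExponent
    congr 2
    ext γ
    exact eventually_congr ((eventually_gt_atTop 0).mono fun t ht =>
      hasNonzeroSolution_iff_formBox hpos hρ1 Θ ht)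
  have hV : uniformWeightedExponent ρ σ Θ.transpose = sSup ((fun x : ℝ => (x : EReal)) '' U) := by
    unfold uniformWeightedExponent
    congr 2
    ext γ
    exact eventually_congr ((eventually_gt_atTop 0).mono fun t ht =>
      hasNonzeroSolution_iff_pointBox hpos hρ1 Θ ht)
  generalize uniformWeightedExponent σ ρ Θ = W at hW ⊢
  generalize uniformWeightedExponent ρ σ Θ.transpose = V at hV ⊢
  have hW1 : 1 ≤ W := by
    rw [hW]
    exact EReal.le_sSup_coe_image_of_forall_lt (a := 1) fun γ hγ => eventually_formBox hs hγ
  have hV1 : 1 ≤ V := by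
    rw [hV]
    exact EReal.le_sSup_coe_image_of_forall_lt (a := 1) fun γ hγ => eventually_pointBox hs hγ
  have hUle : ∀ γ ∈ U, (Irrational p → σ 0 * γ ≤ 1) ∧ (Irrational q → σ 1 * γ ≤ 1) := by
    intro γ hγ
    rcases le_or_gt γ 0 with h0 | h0
    · exact ⟨fun _ => by nlinarith, fun _ => by nlinarith⟩
    · rw [mul_comm (σ 0), mul_comm (σ 1)]
      exact le_one_of_eventually_pointBox (mul_pos h0 h₁) (mul_pos h0 h₂) hγ
  have hVle : ∀ s : ℝ, 0 < s → (∀ γ ∈ U, s * γ ≤ 1) → V ≤ ((1 / s : ℝ) : EReal) := by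
    intro s hs0 h
    rw [hV]
    refine sSup_le ?_
    rintro _ ⟨γ, hγ, rfl⟩
    rw [EReal.coe_le_coe_iff, le_div_iff₀ hs0, mul_comm]
    exact h γ hγ
  -- If p is the irrational entry, the bound 1 / σ 0 is even stronger, since σ 1 ≤ σ 0.
  have hVσ : V ≤ ((1 / σ 1 : ℝ) : EReal) := by
    refine hVle _ h₂ fun γ hγ => ?_
    rcases hirr with h | h
    · have := (hUle γ hγ).1 h
      rcases le_or_gt γ 0 with h0 | h0 <;> nlinarith
    · exact (hUle γ hγ).2 h
  induction V with
  | bot => exact absurd hV1 (not_le.2 (EReal.bot_lt_coe 1))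
  | top => exact absurd hVσ (by simp)
  | coe v =>
    have hv1 : 1 ≤ v := by exact_mod_cast hV1
    have hv2 : σ 1 * v ≤ 1 := by
      rwa [EReal.coe_le_coe_iff, le_div_iff₀ h₂, mul_comm] at hVσ
    have hUv : ∀ γ ∈ U, γ ≤ v := fun γ hγ =>
      EReal.coe_le_coe_iff.1 (hV ▸ le_sSup ⟨γ, hγ, rfl⟩)
    have hvU : ∀ γ < v, γ ∈ U := by
      intro γ hγ
      obtain ⟨γ', hγ', hlt⟩ := EReal.exists_mem_lt_of_lt_sSup_coe_image
        (hV ▸ EReal.coe_lt_coe_iff.2 hγ)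
      filter_upwards [hγ', eventually_ge_atTop 1] with t ht ht1
      exact ht.mono le_rfl (Real.rpow_le_rpow_of_exponent_le ht1 (by nlinarith))
        (Real.rpow_le_rpow_of_exponent_le ht1 (by nlinarith))
    refine ⟨one_le_add_of_transfer h₁ h₂ hs hv1 hW hW1 ?_,
      add_le_one_of_transfer h₁ h₂ hs hv1 hv2 hvU hW1 ?_, fun hirr0 => ?_⟩
    · intro α hα hα1
      have hα0 : 0 < α := by linarith
      by_contra! hlt
      obtain ⟨γ, hvγ, hγ⟩ := exists_between (show v < (1 - σ 1 / α) / σ 0 by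
        rw [lt_div_iff₀ h₁]; linarith)
      rw [lt_div_iff₀ h₁] at hγ
      refine (hUv γ ?_).not_gt hvγ
      refine eventually_pointBox_of_eventually_formBox (by linarith) (by linarith) h₁ h₂ hα1 hα hγ ?_
      have hinv : α⁻¹ ≤ 1 := inv_le_one_of_one_le₀ hα1
      rw [div_eq_mul_inv] at hγ ⊢
      -- The condition for the second weight follows from that for the first: the difference in `e3`
      -- is (σ 0 - σ 1)(1 - α⁻¹) ≥ 0.
      have e1 : γ * σ 1 * σ 0 < (1 - σ 1 * α⁻¹) * σ 1 := by nlinarith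
      have e2 : (1 - σ 1 * α⁻¹) * σ 1 ≤ (1 - σ 0 * α⁻¹) * σ 0 := by
        have e3 : (1 - σ 0 * α⁻¹) * σ 0 - (1 - σ 1 * α⁻¹) * σ 1
            = (σ 0 - σ 1) * (1 - (σ 0 + σ 1) * α⁻¹) := by ring
        rw [hs, one_mul] at e3
        have := mul_nonneg (sub_nonneg.2 h₂₁) (sub_nonneg.2 hinv)
        linarith
      exact lt_of_mul_lt_mul_right (e1.trans_le e2) h₁.le
    · intro γ hγ hγ1 hγ2
      rw [hW]
      refine EReal.le_sSup_coe_image_of_forall_lt fun α hα => ?_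
      have hd : 0 < 1 - σ 1 * γ := by linarith
      -- The exponent σ 0 / (1 - σ 1 * γ) turns the first condition into an equality; the second
      -- reduces to (σ 0 - σ 1)(γ - 1) ≥ 0.
      refine eventually_formBox_of_eventually_pointBox h₂ h₂₁ (div_pos h₁ hd) ?_ ?_ hα hγ
      · rw [div_div_cancel₀ h₁.ne']
        linarith
      · rw [div_div_eq_mul_div, le_div_iff₀ h₁]
        have e : σ 1 * (1 - σ 1 * γ) - (1 - γ * σ 0) * σ 0
            = (σ 0 - σ 1) * (γ * (σ 0 + σ 1) - 1) := by ring
        rw [hs, mul_one] at e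
        have := mul_nonneg (sub_nonneg.2 h₂₁) (sub_nonneg.2 hγ1)
        linarith
    · have h := hVle _ h₁ fun γ hγ => (hUle γ hγ).1 hirr0
      rw [EReal.coe_le_coe_iff, le_div_iff₀ h₁, mul_comm] at h
      exact_mod_cast h
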